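/- Let $K$ be a number field with ring of integers $\mathfrak{o}_K$. Let $X$ be its set of places, $X_\infty\subseteq X$ the set of archimedean places, and for $v\in X$ let $K_v$ be the completion of $K$ at $v$; for $v\in X\setminus X_\infty$ let $\mathfrak{o}_v\subseteq K_v$ be the valuation ring, $\mathfrak{m}_v$ its maximal ideal, and write $v(\cdot)$ also for the additive valuation on $K_v$ (with $v(0)=\infty$). Let $$\mathbb{A}_K=\Big\{\alpha=(\alpha_v)_{v}\in\prod_{v\in X}K_v : \alpha_v\in\mathfrak{o}_v\text{ for all but finitely many } v\in X\setminus X_\infty\Big\}$$ be the adele ring. Let $S_0\subseteq X$ be a finite set containing $X_\infty$, put $\Omega=X\setminus S_0$ and $\mathbb{A}_{K,S_0}=\{\alpha\in\mathbb{A}_K : \alpha_v\in\mathfrak{o}_v\text{ for all }v\in\Omega\}$. An ultrafilter $\mathcal{U}$ on $\Omega$ is principal if some point of $\Omega$ lies in all members of $\mathcal{U}$. For $v\in X$, for a non-principal ultrafilter $\mathcal{U}$ on $\Omega$, and for $\beta\in\mathbb{A}_K$, put $$M_v=\{\alpha\in\mathbb{A}_K : \alpha_v=0\},$$ $$M_{\mathcal{U}}=\{\alpha\in\mathbb{A}_K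 : \{v\in\Omega : \alpha_v\in\mathfrak{m}_v\}\in\mathcal{U}\},\qquad m_{\mathcal{U}}=\{\alpha\in\mathbb{A}_K : \{v\in\Omega : \alpha_v=0\}\in\mathcal{U}\},$$ $$\mathfrak{p}_{\mathcal{U}}^{\beta}=\{\alpha\in\mathbb{A}_K : \text{there are } Y\in\mathcal{U},\ n\in\mathbb{N}\text{ with } v(\alpha_v^n)\geq v(\beta_v)\text{ for all }v\in Y\}.$$ The sets $M_v$, $M_{\mathcal{U}}$ and $m_{\mathcal{U}}$ are ideals of $\mathbb{A}_K$, and: 1. The maximal ideals of $\mathbb{A}_K$ are exactly the $M_v$ for $v\in X$ (which are also minimal prime ideals) and the $M_{\mathcal{U}}$ for $\mathcal{U}$ a non-principal ultrafilter on $\Omega$. 2. The minimal prime ideals of $\mathbb{A}_K$ are exactly the $M_v$ for $v\in X$ (which are also maximal) and the $m_{\mathcal{U}}$ for $\mathcal{U}$ a non-principal ultrafilter on $\Omega$. Moreover, $m_{\mathcal{U}}$ is the only minimal prime ideal contained in $M_{\mathcal{U}}$, and $M_{\mathcal{U}}$ is the only maximal ideal containing $m_{\mathcal{U}}$. 3.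 If $\mathfrak{p}$ is a prime ideal of $\mathbb{A}_K$ that is neither maximal nor minimal, there is exactly one non-principal ultrafilter $\mathcal{U}$ on $\Omega$ such that $m_{\mathcal{U}}\subsetneq\mathfrak{p}\subsetneq M_{\mathcal{U}}$, and for this $\mathcal{U}$ $$\mathfrak{p}=\bigcup_{\beta\in\mathfrak{p}\cap\mathbb{A}_{K,S_0}}\mathfrak{p}_{\mathcal{U}}^{\beta}.$$ -/

import Mathlib

open scoped NumberField

namespace AdeleSpec

open IsDedekindDomain

/-- An ultrafilter is principal if some point lies in all of its members. -/
def IsPrincipal {Ω : Type*} (U : Ultrafilter Ω) : Prop :=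
  ∃ x : Ω, ∀ Y ∈ U, x ∈ Y

/-- The non-principal ultrafilters on `Ω`. -/
abbrev FreeUltrafilter (Ω : Type*) : Type _ := {U : Ultrafilter Ω // ¬ IsPrincipal U}

theorem FreeUltrafilter.le_cofinite {Ω : Type*} (U : FreeUltrafilter Ω) :
    (U.1 : Filter Ω) ≤ Filter.cofinite := by
  rcases U.1.le_cofinite_or_eq_pure with h | ⟨a, ha⟩
  · exact h
  · refine absurd ⟨a, fun Y hY => ?_⟩ U.2
    rw [ha] at hY
    exact Ultrafilter.mem_pure.1 hY

section

variable (K : Type*) [Field K] [NumberField K]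

/-- The adele ring of `K`: families `α` with a component `α.1 w` in the completion of `K` at every
infinite place `w`, and a component `α.2 v` in the `v`-adic completion of `K` for every nonzero
prime `v` of `𝓞 K`, which is `v`-integral for all but finitely many `v`. -/
abbrev Adeles : Type _ := NumberField.AdeleRing (𝓞 K) K

/-- The set of places of `K`: the infinite ones, and the finite ones, given by the
nonzero prime ideals of `𝓞 K`. -/
abbrev Place : Type _ := NumberField.InfinitePlace K ⊕ HeightOneSpectrum (𝓞 K)

variable {K}

/-- The complement of a set `S` of places that contains all the infinite ones (so that
the complement consists of finite places). -/
abbrev PlacesOutside (S : Set (Place K)) : Type _ :=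
  {v : HeightOneSpectrum (𝓞 K) // (Sum.inr v : Place K) ∉ S}

/-- The ring of `S`-adeles, i.e. of the adeles that are integral at all (finite) places
outside `S`, as a subring of the adele ring. -/
def sAdeles (S : Set (Place K)) : Subring (Adeles K) where
  carrier := {α | ∀ v : PlacesOutside S, α.2 v.1 ∈ v.1.adicCompletionIntegers K}
  mul_mem' ha hb v := mul_mem (ha v) (hb v)
  one_mem' v := one_mem (v.1.adicCompletionIntegers K)
  add_mem' ha hb v := add_mem (ha v) (hb v)
  zero_mem' v := zero_mem (v.1.adicCompletionIntegers K)
  neg_mem' ha v := neg_mem (ha v)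

/-- The ideal `M_v = {α | α_v = 0}` of the adele ring, for a place `v`, infinite or finite. -/
def placeIdeal : Place K → Ideal (Adeles K)
  | Sum.inl w =>
    { carrier := {α | α.1 w = 0}
      add_mem' := fun {a b} (ha : a.1 w = 0) (hb : b.1 w = 0) =>
        show a.1 w + b.1 w = 0 by rw [ha, hb, add_zero]
      zero_mem' := rfl
      smul_mem' := fun c a (ha : a.1 w = 0) =>
        show c.1 w * a.1 w = 0 by rw [ha, mul_zero] }
  | Sum.inr v =>
    { carrier := {α | α.2 v = 0}
      add_mem' := fun {a b} (ha : a.2 v = 0) (hb : b.2 v = 0) =>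
        show a.2 v + b.2 v = 0 by rw [ha, hb, add_zero]
      zero_mem' := rfl
      smul_mem' := fun c a (ha : a.2 v = 0) =>
        show c.2 v * a.2 v = 0 by rw [ha, mul_zero] }

/-- The condition `α_v ∈ 𝔪_v`, for a finite place `v`, where `𝔪_v` is the maximal ideal of the
valuation ring of the completion at `v`. -/
def MemMax (α : Adeles K) (v : HeightOneSpectrum (𝓞 K)) : Prop :=
  ∃ h : α.2 v ∈ v.adicCompletionIntegers K,
    (⟨α.2 v, h⟩ : v.adicCompletionIntegers K) ∈
      IsLocalRing.maximalIdeal (v.adicCompletionIntegers K)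

theorem memMax_iff (α : Adeles K) (v : HeightOneSpectrum (𝓞 K)) :
    MemMax α v ↔ Valued.v (α.2 v) < 1 := by
  unfold MemMax
  constructor
  · rintro ⟨h, h2⟩
    rw [IsLocalRing.mem_maximalIdeal, mem_nonunits_iff,
      HeightOneSpectrum.adicCompletionIntegers.isUnit_iff_valued_eq_one] at h2
    exact lt_of_le_of_ne h h2
  · intro h
    refine ⟨h.le, ?_⟩
    rw [IsLocalRing.mem_maximalIdeal, mem_nonunits_iff,
      HeightOneSpectrum.adicCompletionIntegers.isUnit_iff_valued_eq_one]
    exact h.ne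

variable {S : Set (Place K)}

theorem eventually_integral (U : FreeUltrafilter (PlacesOutside S)) (α : Adeles K) :
    ∀ᶠ v : PlacesOutside S in (U.1 : Filter (PlacesOutside S)), α.2 v.1 ∈ v.1.adicCompletionIntegers K :=
  U.le_cofinite (Subtype.val_injective.tendsto_cofinite.eventually α.2.2)

/-- The ideal `M_U = {α | {v ∉ S | α_v ∈ 𝔪_v} ∈ U}` of the adele ring. -/
def ultraMax (U : FreeUltrafilter (PlacesOutside S)) : Ideal (Adeles K) where
  carrier := {α | {v : PlacesOutside S | MemMax α v.1} ∈ U.1}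
  add_mem' := by
    intro a b ha hb
    filter_upwards [ha, hb] with v hav hbv
    exact (memMax_iff (a + b) v.1).2
      (Valuation.map_add_lt Valued.v ((memMax_iff a v.1).1 hav) ((memMax_iff b v.1).1 hbv))
  zero_mem' := Filter.univ_mem' fun v =>
    (memMax_iff 0 v.1).2 (lt_of_eq_of_lt (map_zero Valued.v) zero_lt_one)
  smul_mem' := by
    intro c a ha
    filter_upwards [ha, eventually_integral U c] with v hav hcv
    refine (memMax_iff (c * a) v.1).2 (lt_of_eq_of_lt (map_mul Valued.v (c.2 v.1) (a.2 v.1)) ?_)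
    exact lt_of_le_of_lt (mul_le_of_le_one_left' hcv) ((memMax_iff a v.1).1 hav)

/-- The ideal `m_U = {α | {v ∉ S | α_v = 0} ∈ U}` of the adele ring. -/
def ultraMin (U : FreeUltrafilter (PlacesOutside S)) : Ideal (Adeles K) where
  carrier := {α | {v : PlacesOutside S | α.2 v.1 = 0} ∈ U.1}
  add_mem' := by
    intro a b ha hb
    filter_upwards [ha, hb] with v (hav : a.2 v.1 = 0) (hbv : b.2 v.1 = 0)
    show a.2 v.1 + b.2 v.1 = 0
    rw [hav, hbv, add_zero]
  zero_mem' := Filter.univ_mem' fun v => rfl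
  smul_mem' := by
    intro c a ha
    filter_upwards [ha] with v (hav : a.2 v.1 = 0)
    show c.2 v.1 * a.2 v.1 = 0
    rw [hav, mul_zero]

/-- The set `p_U^β` of the adeles `α` such that, for some `Y ∈ U` and `n ∈ ℕ`, one has
`v(α_v ^ n) ≥ v(β_v)` for all `v ∈ Y`. The valuation of the completion is written
multiplicatively in Mathlib, which reverses the inequality. -/
def ultraSet (U : FreeUltrafilter (PlacesOutside S)) (β : Adeles K) : Set (Adeles K) :=
  {α | ∃ Y ∈ U.1, ∃ n : ℕ, ∀ v ∈ Y, Valued.v (α.2 v.1 ^ n) ≤ Valued.v (β.2 v.1)}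

end

end AdeleSpec

/-!
The adele ring contains the idempotent `e_T` (`placeIndicator T`) for every set `T` of places, and
an adele `β` divides `e_T α` as soon as it does so componentwise on `T`, with integral quotients at
almost all places (`dvd_placeIndicator_mul`).

Let `p` be a prime ideal. Exactly one of `e_T` and `e_{Tᶜ}` is in `p`, and the sets `T` with
`e_T ∉ p` form an ultrafilter on the places (`placeUltrafilter`). If it contains a singleton
`{x}`, then `p` contains `M_x`, as `e_{x} M_x = 0`; since `M_x` is maximal, `p = M_x`. Otherwise the
ultrafilter contains the complement of the finite set `S`, and restricts to a non-principal
ultrafilter `U` outside `S`. Then `m_U ≤ p` (`exists_ultraMin_le`): an adele `α` vanishing on some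
`Y ∈ U` satisfies `e_Y α = 0` with `e_Y ∉ p`. Moreover `p ≤ M_U` (`le_ultraMax_of_ultraMin_le`): an
adele outside `M_U` is a unit at all places of some `Y ∈ U`, hence divides `e_Y`. Finally `m_U ≤ p`
determines `U` (`eq_of_ultraMin_le`), because `Y ∈ U` if and only if `e_Y ∉ p`.

So the prime ideals are the `M_x`, which are incomparable with all the others, and those lying
between `m_U` and `M_U` for a unique `U`. As `m_U` is prime and `M_U` is proper, this yields the
maximal and the minimal primes. For a prime `p` above `m_U` and `β ∈ p`, the set `p_U^β` lies in
`p`, since `v(α_v ^ n) ≥ v(β_v)` on `Y` makes `β` a divisor of `e_Y α ^ n`; and `α ∈ p` lies in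
`p_U^β` for `β = e_Y α`, where `Y` consists of the places outside `S` where `α` is integral.
-/

namespace AdeleSpec

open IsDedekindDomain

/-! ### Sets of places outside `S` -/

section

variable {K : Type*} [Field K] {S : Set (Place K)}

/-- The set of places underlying a set of places outside `S`. -/
def toPlaces (Y : Set (PlacesOutside S)) : Set (Place K) :=
  (fun v : PlacesOutside S => (Sum.inr v.1 : Place K)) '' Y

theorem inl_notMem_toPlaces (Y : Set (PlacesOutside S)) (w : NumberField.InfinitePlace K) :
    (Sum.inl w : Place K) ∉ toPlaces Y := by
  rintro ⟨_, _, h⟩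
  cases h

theorem injective_inr_val :
    Function.Injective (fun v : PlacesOutside S => (Sum.inr v.1 : Place K)) :=
  Sum.inr_injective.comp Subtype.val_injective

theorem inr_val_mem_toPlaces {Y : Set (PlacesOutside S)} {v : PlacesOutside S} :
    (Sum.inr v.1 : Place K) ∈ toPlaces Y ↔ v ∈ Y :=
  injective_inr_val.mem_set_image

theorem forall_inr_mem_toPlaces {Y : Set (PlacesOutside S)} {P : HeightOneSpectrum (𝓞 K) → Prop} :
    (∀ v, (Sum.inr v : Place K) ∈ toPlaces Y → P v) ↔ ∀ v ∈ Y, P v.1 := by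
  refine ⟨fun h v hv => h v.1 (inr_val_mem_toPlaces.2 hv), ?_⟩
  rintro h v ⟨u, hu, huv⟩
  cases huv
  exact h u hu

end

section

variable {K : Type*} [Field K] [NumberField K]

/-! ### Idempotents and divisibility in the adele ring -/

theorem adele_ext {a b : Adeles K} (h₁ : ∀ w, a.1 w = b.1 w) (h₂ : ∀ v, a.2 v = b.2 v) : a = b :=
  Prod.ext (funext h₁) (RestrictedProduct.ext _ _ h₂)

open Classical in
/-- The idempotent adele that is `1` at the places in `T` and `0` at the others. -/
noncomputable def placeIndicator (T : Set (Place K)) : Adeles K :=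
  (fun w => if Sum.inl w ∈ T then 1 else 0,
    ⟨fun v => if Sum.inr v ∈ T then 1 else 0, Filter.Eventually.of_forall fun v => by
      dsimp only
      split_ifs
      · exact one_mem (v.adicCompletionIntegers K)
      · exact zero_mem (v.adicCompletionIntegers K)⟩)

open Classical in
theorem placeIndicator_fst (T : Set (Place K)) (w : NumberField.InfinitePlace K) :
    (placeIndicator T).1 w = if Sum.inl w ∈ T then 1 else 0 := rfl

open Classical in
theorem placeIndicator_snd (T : Set (Place K)) (v : HeightOneSpectrum (𝓞 K)) :
    (placeIndicator T).2 v = if Sum.inr v ∈ T then 1 else 0 := rfl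

theorem mul_fst_apply (a b : Adeles K) (w : NumberField.InfinitePlace K) :
    (a * b).1 w = a.1 w * b.1 w := rfl

theorem mul_snd_apply (a b : Adeles K) (v : HeightOneSpectrum (𝓞 K)) :
    (a * b).2 v = a.2 v * b.2 v := rfl

theorem add_fst_apply (a b : Adeles K) (w : NumberField.InfinitePlace K) :
    (a + b).1 w = a.1 w + b.1 w := rfl

theorem add_snd_apply (a b : Adeles K) (v : HeightOneSpectrum (𝓞 K)) :
    (a + b).2 v = a.2 v + b.2 v := rfl

theorem zero_fst_apply (w : NumberField.InfinitePlace K) : (0 : Adeles K).1 w = 0 := rfl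

theorem zero_snd_apply (v : HeightOneSpectrum (𝓞 K)) : (0 : Adeles K).2 v = 0 := rfl

theorem one_fst_apply (w : NumberField.InfinitePlace K) : (1 : Adeles K).1 w = 1 := rfl

theorem one_snd_apply (v : HeightOneSpectrum (𝓞 K)) : (1 : Adeles K).2 v = 1 := rfl

theorem placeIndicator_mul (T T' : Set (Place K)) :
    placeIndicator T * placeIndicator T' = placeIndicator (T ∩ T') := by
  refine adele_ext (fun w => ?_) (fun v => ?_)
  · simp only [mul_fst_apply, placeIndicator_fst, Set.mem_inter_iff]
    split_ifs <;> simp_all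
  · simp only [mul_snd_apply, placeIndicator_snd, Set.mem_inter_iff]
    split_ifs <;> simp_all

theorem placeIndicator_empty : placeIndicator (∅ : Set (Place K)) = 0 := by
  refine adele_ext (fun w => ?_) (fun v => ?_)
  · simp [placeIndicator_fst, zero_fst_apply]
  · simp [placeIndicator_snd, zero_snd_apply]

theorem placeIndicator_add_compl (T : Set (Place K)) :
    placeIndicator T + placeIndicator Tᶜ = 1 := by
  refine adele_ext (fun w => ?_) (fun v => ?_)
  · simp only [add_fst_apply, placeIndicator_fst, Set.mem_compl_iff, one_fst_apply]
    split_ifs <;> simp_all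
  · simp only [add_snd_apply, placeIndicator_snd, Set.mem_compl_iff, one_snd_apply]
    split_ifs <;> simp_all

/-- Componentwise division: `β` divides `α` cut off to `T` if this holds in every component
in `T`, and the quotients are integral at almost all finite places in `T`. -/
theorem dvd_placeIndicator_mul {α β : Adeles K} {T : Set (Place K)}
    (h₁ : ∀ w, Sum.inl w ∈ T → β.1 w = 0 → α.1 w = 0)
    (h₂ : ∀ v, Sum.inr v ∈ T → β.2 v = 0 → α.2 v = 0)
    (h₃ : ∀ᶠ v : HeightOneSpectrum (𝓞 K) in Filter.cofinite,
      Sum.inr v ∈ T → Valued.v (α.2 v) ≤ Valued.v (β.2 v)) :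
    β ∣ placeIndicator T * α := by
  classical
  refine ⟨(fun w => if Sum.inl w ∈ T then α.1 w / β.1 w else 0,
    ⟨fun v => if Sum.inr v ∈ T then α.2 v / β.2 v else 0, ?_⟩), ?_⟩
  · filter_upwards [h₃] with v hv
    rw [SetLike.mem_coe, HeightOneSpectrum.mem_adicCompletionIntegers]
    split_ifs with hT
    · rw [map_div₀]
      exact div_le_one_of_le₀ (hv hT) zero_le
    · simp
  · refine adele_ext (fun w => ?_) (fun v => ?_)
    · show (if Sum.inl w ∈ T then 1 else 0) * α.1 w =
        β.1 w * (if Sum.inl w ∈ T then α.1 w / β.1 w else 0)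
      split_ifs with hT
      · rw [one_mul, mul_div_cancel_of_imp' (h₁ w hT)]
      · rw [zero_mul, mul_zero]
    · show (if Sum.inr v ∈ T then 1 else 0) * α.2 v =
        β.2 v * (if Sum.inr v ∈ T then α.2 v / β.2 v else 0)
      split_ifs with hT
      · rw [one_mul, mul_div_cancel_of_imp' (h₂ v hT)]
      · rw [zero_mul, mul_zero]

theorem placeIndicator_mem_or_compl_mem {p : Ideal (Adeles K)} (hp : p.IsPrime)
    (T : Set (Place K)) : placeIndicator T ∈ p ∨ placeIndicator Tᶜ ∈ p := by
  refine hp.mem_or_mem ?_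
  rw [placeIndicator_mul, Set.inter_compl_self, placeIndicator_empty]
  exact p.zero_mem

theorem placeIndicator_compl_mem_iff {p : Ideal (Adeles K)} (hp : p.IsPrime)
    (T : Set (Place K)) : placeIndicator Tᶜ ∈ p ↔ placeIndicator T ∉ p := by
  refine ⟨fun h h' => hp.ne_top ((Ideal.eq_top_iff_one p).2 ?_), fun h =>
    (placeIndicator_mem_or_compl_mem hp T).resolve_left h⟩
  rw [← placeIndicator_add_compl T]
  exact p.add_mem h' h

theorem placeIndicator_mem_of_subset {p : Ideal (Adeles K)} {T T' : Set (Place K)}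
    (h : T ⊆ T') (h' : placeIndicator T' ∈ p) : placeIndicator T ∈ p := by
  rw [← Set.inter_eq_left.2 h, ← placeIndicator_mul]
  exact p.mul_mem_left _ h'

/-! ### The ideals of adeles vanishing at a place -/

theorem mem_placeIdeal_inl {w : NumberField.InfinitePlace K} {α : Adeles K} :
    α ∈ placeIdeal (Sum.inl w) ↔ α.1 w = 0 := Iff.rfl

theorem mem_placeIdeal_inr {v : HeightOneSpectrum (𝓞 K)} {α : Adeles K} :
    α ∈ placeIdeal (Sum.inr v) ↔ α.2 v = 0 := Iff.rfl

theorem placeIndicator_mem_placeIdeal {T : Set (Place K)} {x : Place K} :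
    placeIndicator T ∈ placeIdeal x ↔ x ∉ T := by
  rcases x with w | v
  · rw [mem_placeIdeal_inl, placeIndicator_fst]
    split_ifs with h <;> simp [h]
  · rw [mem_placeIdeal_inr, placeIndicator_snd]
    split_ifs with h <;> simp [h]

theorem placeIndicator_singleton_mul_eq_zero {x : Place K} {α : Adeles K}
    (h : α ∈ placeIdeal x) : placeIndicator {x} * α = 0 := by
  have h0 : (0 : Adeles K) ∣ placeIndicator {x} * α := by
    refine dvd_placeIndicator_mul ?_ ?_ ?_
    · rintro w rfl -
      exact h
    · rintro v rfl -
      exact h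
    · refine Filter.Eventually.of_forall ?_
      rintro v rfl
      rw [mem_placeIdeal_inr.1 h, zero_snd_apply]
  exact zero_dvd_iff.1 h0

theorem placeIdeal_isMaximal (x : Place K) : (placeIdeal x).IsMaximal := by
  rw [Ideal.isMaximal_iff]
  refine ⟨?_, fun J α hJ hα hαJ => ?_⟩
  · rw [← placeIndicator_add_compl {x}, Ideal.add_mem_iff_left]
    · simp [placeIndicator_mem_placeIdeal]
    · simp [placeIndicator_mem_placeIdeal]
  · have hdvd : α ∣ placeIndicator {x} * 1 := by
      refine dvd_placeIndicator_mul ?_ ?_ ?_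
      · rintro w rfl h
        exact absurd h hα
      · rintro v rfl h
        exact absurd h hα
      · have hx : {v : HeightOneSpectrum (𝓞 K) | Sum.inr v = x}.Finite :=
          (Set.finite_singleton x).preimage Sum.inr_injective.injOn
        filter_upwards [hx.compl_mem_cofinite] with v hv hv'
        exact absurd hv' hv
    rw [mul_one] at hdvd
    rw [← placeIndicator_add_compl {x}]
    exact J.add_mem (J.mem_of_dvd hdvd hαJ) (hJ (by simp [placeIndicator_mem_placeIdeal]))

theorem eq_placeIdeal_of_notMem {p : Ideal (Adeles K)} (hp : p.IsPrime) {x : Place K}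
    (hx : placeIndicator {x} ∉ p) : p = placeIdeal x := by
  refine ((placeIdeal_isMaximal x).eq_of_le hp.ne_top fun α hα => ?_).symm
  refine (hp.mem_or_mem ?_).resolve_left hx
  rw [placeIndicator_singleton_mul_eq_zero hα]
  exact p.zero_mem

/-! ### Prime ideals and ultrafilters -/

variable {S : Set (Place K)}

/-- The special case of `dvd_placeIndicator_mul` where the quotients are integral throughout. -/
theorem dvd_placeIndicator_toPlaces_mul {α β : Adeles K} {Y : Set (PlacesOutside S)}
    (h : ∀ v ∈ Y, Valued.v (α.2 v.1) ≤ Valued.v (β.2 v.1)) :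
    β ∣ placeIndicator (toPlaces Y) * α := by
  have h' := forall_inr_mem_toPlaces
    (P := fun v => Valued.v (α.2 v) ≤ Valued.v (β.2 v)) |>.2 h
  refine dvd_placeIndicator_mul (fun w hw => absurd hw (inl_notMem_toPlaces Y w))
    (fun v hv h0 => ?_) (Filter.Eventually.of_forall h')
  have := h' v hv
  rwa [h0, map_zero, le_zero_iff, map_eq_zero] at this

theorem mem_ultraMin {U : FreeUltrafilter (PlacesOutside S)} {α : Adeles K} :
    α ∈ ultraMin U ↔ {v : PlacesOutside S | α.2 v.1 = 0} ∈ U.1 := Iff.rfl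

theorem mem_ultraMax {U : FreeUltrafilter (PlacesOutside S)} {α : Adeles K} :
    α ∈ ultraMax U ↔ {v : PlacesOutside S | Valued.v (α.2 v.1) < 1} ∈ U.1 := by
  simp only [← memMax_iff]
  rfl

theorem ultraMin_le_ultraMax (U : FreeUltrafilter (PlacesOutside S)) :
    ultraMin U ≤ ultraMax U := by
  intro α hα
  rw [mem_ultraMax]
  filter_upwards [mem_ultraMin.1 hα] with v (hv : α.2 v.1 = 0)
  simp [hv]

theorem placeIndicator_mem_ultraMin {U : FreeUltrafilter (PlacesOutside S)} {T : Set (Place K)} :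
    placeIndicator T ∈ ultraMin U ↔ {v : PlacesOutside S | Sum.inr v.1 ∉ T} ∈ U.1 := by
  simp [mem_ultraMin, placeIndicator_snd]

theorem ultraMin_isPrime (U : FreeUltrafilter (PlacesOutside S)) : (ultraMin U).IsPrime := by
  refine ⟨fun h => ?_, fun {α β} h => ?_⟩
  · have h1 := mem_ultraMin.1 ((Ideal.eq_top_iff_one _).1 h)
    simp [one_snd_apply] at h1
  · simp only [mem_ultraMin, mul_snd_apply, mul_eq_zero, Set.ofPred_or] at h ⊢
    exact Ultrafilter.union_mem_iff.1 h

theorem ultraMax_ne_top (U : FreeUltrafilter (PlacesOutside S)) : ultraMax U ≠ ⊤ := by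
  intro h
  have h1 := mem_ultraMax.1 ((Ideal.eq_top_iff_one _).1 h)
  simp [one_snd_apply] at h1

/-- A prime ideal above `m_U` contains the indicator of a set of places outside `S` exactly when
the set is not in `U`, so that it determines `U`. -/
theorem mem_iff_placeIndicator_notMem {U : FreeUltrafilter (PlacesOutside S)}
    {p : Ideal (Adeles K)} (hp : p.IsPrime) (h : ultraMin U ≤ p) (Y : Set (PlacesOutside S)) :
    Y ∈ U.1 ↔ placeIndicator (toPlaces Y) ∉ p := by
  constructor
  · intro hY
    rw [← placeIndicator_compl_mem_iff hp]
    refine h (placeIndicator_mem_ultraMin.2 ?_)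
    simpa [inr_val_mem_toPlaces] using hY
  · intro hY
    by_contra hU
    refine hY (h (placeIndicator_mem_ultraMin.2 ?_))
    simp only [inr_val_mem_toPlaces]
    exact Ultrafilter.compl_mem_iff_notMem.2 hU

theorem eq_of_ultraMin_le {U U' : FreeUltrafilter (PlacesOutside S)} {p : Ideal (Adeles K)}
    (hp : p.IsPrime) (h : ultraMin U ≤ p) (h' : ultraMin U' ≤ p) : U = U' :=
  Subtype.ext <| Ultrafilter.ext fun Y =>
    (mem_iff_placeIndicator_notMem hp h Y).trans (mem_iff_placeIndicator_notMem hp h' Y).symm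

theorem not_ultraMin_le_placeIdeal (U : FreeUltrafilter (PlacesOutside S)) (x : Place K) :
    ¬ ultraMin U ≤ placeIdeal x := by
  intro h
  have hx : placeIndicator {x} ∈ ultraMin U := by
    rw [placeIndicator_mem_ultraMin]
    have : {v : PlacesOutside S | (Sum.inr v.1 : Place K) = x}.Finite :=
      (Set.finite_singleton x).preimage injective_inr_val.injOn
    exact U.le_cofinite this.compl_mem_cofinite
  exact placeIndicator_mem_placeIdeal.1 (h hx) rfl

/-- If a prime ideal above `m_U` contained an adele `α` outside `M_U`, then `α` would be a unit at
all places of some member `Y` of `U`, hence would divide the indicator of `Y`. -/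
theorem le_ultraMax_of_ultraMin_le {U : FreeUltrafilter (PlacesOutside S)} {p : Ideal (Adeles K)}
    (hp : p.IsPrime) (h : ultraMin U ≤ p) : p ≤ ultraMax U := by
  intro α hα
  by_contra hαU
  rw [mem_ultraMax, ← Ultrafilter.compl_mem_iff_notMem] at hαU
  refine (mem_iff_placeIndicator_notMem hp h _).1 hαU ?_
  have hdvd : α ∣ placeIndicator (toPlaces {v : PlacesOutside S | Valued.v (α.2 v.1) < 1}ᶜ) * 1 :=
    dvd_placeIndicator_toPlaces_mul fun v hv => by
      simpa [one_snd_apply] using hv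
  rw [mul_one] at hdvd
  exact p.mem_of_dvd hdvd hα

/-- The ultrafilter of a prime ideal `p` of the adele ring: the sets of places whose indicator
is not in `p`, or, equivalently, the indicator of whose complement is in `p`. -/
noncomputable def placeUltrafilter (p : Ideal (Adeles K)) (hp : p.IsPrime) :
    Ultrafilter (Place K) :=
  Ultrafilter.ofComplNotMemIff
    { sets := {T | placeIndicator Tᶜ ∈ p}
      univ_sets := by
        simp [placeIndicator_empty]
      sets_of_superset := fun {T T'} hT h =>
        placeIndicator_mem_of_subset (Set.compl_subset_compl.2 h) hT
      inter_sets := fun {T T'} hT hT' => by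
        have hT : placeIndicator Tᶜ ∈ p := hT
        have hT' : placeIndicator T'ᶜ ∈ p := hT'
        show placeIndicator (T ∩ T')ᶜ ∈ p
        rw [placeIndicator_compl_mem_iff hp] at hT hT' ⊢
        rw [← placeIndicator_mul]
        exact fun h => (hp.mem_or_mem h).elim hT hT' }
    fun T => by
      show ¬ placeIndicator Tᶜᶜ ∈ p ↔ placeIndicator Tᶜ ∈ p
      rw [compl_compl, placeIndicator_compl_mem_iff hp]

theorem mem_placeUltrafilter {p : Ideal (Adeles K)} (hp : p.IsPrime) {T : Set (Place K)} :
    T ∈ placeUltrafilter p hp ↔ placeIndicator Tᶜ ∈ p := Iff.rfl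

theorem exists_ultraMin_le {p : Ideal (Adeles K)} (hp : p.IsPrime) (hfin : S.Finite)
    (hinf : ∀ w : NumberField.InfinitePlace K, (Sum.inl w : Place K) ∈ S)
    (hne : ∀ x, p ≠ placeIdeal x) :
    ∃ U : FreeUltrafilter (PlacesOutside S), ultraMin U ≤ p := by
  have hmem : ∀ x : Place K, placeIndicator {x} ∈ p := fun x => by
    by_contra h
    exact hne x (eq_placeIdeal_of_notMem hp h)
  have hcof : (placeUltrafilter p hp : Filter (Place K)) ≤ Filter.cofinite := by
    refine (placeUltrafilter p hp).le_cofinite_or_eq_pure.resolve_right ?_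
    rintro ⟨x, hx⟩
    have : ({x} : Set (Place K)) ∈ placeUltrafilter p hp := by
      rw [hx]
      exact Ultrafilter.mem_pure.2 rfl
    rw [mem_placeUltrafilter, placeIndicator_compl_mem_iff hp] at this
    exact this (hmem x)
  -- The members of the ultrafilter meet the complement of the finite set `S`.
  have hrange : Set.range (fun v : PlacesOutside S => (Sum.inr v.1 : Place K)) ∈
      placeUltrafilter p hp := by
    refine Filter.mem_of_superset (hcof hfin.compl_mem_cofinite) ?_
    rintro (w | v) hx
    · exact absurd (hinf w) hx
    · exact ⟨⟨v, hx⟩, rfl⟩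
  have hU : ¬ IsPrincipal ((placeUltrafilter p hp).comap injective_inr_val hrange) := by
    rintro ⟨x, hx⟩
    refine hx {x}ᶜ ?_ rfl
    rw [Ultrafilter.mem_comap]
    refine Filter.mem_of_superset
      (Filter.inter_mem hrange (hcof (Set.finite_singleton (Sum.inr x.1)).compl_mem_cofinite)) ?_
    rintro _ ⟨⟨v, rfl⟩, hv⟩
    refine ⟨v, ?_, rfl⟩
    rintro rfl
    exact hv rfl
  refine ⟨⟨_, hU⟩, fun α hα => ?_⟩
  have hZ := mem_ultraMin.1 hα
  rw [Ultrafilter.mem_comap, mem_placeUltrafilter, placeIndicator_compl_mem_iff hp] at hZ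
  refine (hp.mem_or_mem (?_ : placeIndicator _ * α ∈ p)).resolve_left hZ
  have h0 : (0 : Adeles K) ∣ placeIndicator (toPlaces {v : PlacesOutside S | α.2 v.1 = 0}) * α :=
    dvd_placeIndicator_toPlaces_mul fun v (hv : α.2 v.1 = 0) => by rw [hv, zero_snd_apply]
  exact p.mem_of_dvd h0 p.zero_mem

theorem ultraMax_isMaximal (U : FreeUltrafilter (PlacesOutside S)) : (ultraMax U).IsMaximal := by
  obtain ⟨q, hq, hUq⟩ := Ideal.exists_le_maximal _ (ultraMax_ne_top U)
  have := le_ultraMax_of_ultraMin_le hq.isPrime ((ultraMin_le_ultraMax U).trans hUq)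
  rwa [hUq.antisymm this]

theorem ultraMin_mem_minimalPrimes (hfin : S.Finite)
    (hinf : ∀ w : NumberField.InfinitePlace K, (Sum.inl w : Place K) ∈ S)
    (U : FreeUltrafilter (PlacesOutside S)) : ultraMin U ∈ minimalPrimes (Adeles K) := by
  rw [minimalPrimes_eq_minimals]
  refine ⟨ultraMin_isPrime U, fun q hq hqU => ?_⟩
  by_cases hne : ∀ x, q ≠ placeIdeal x
  · obtain ⟨U', hU'⟩ := exists_ultraMin_le hq hfin hinf hne
    rwa [eq_of_ultraMin_le (ultraMin_isPrime U) le_rfl (hU'.trans hqU)]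
  · push Not at hne
    obtain ⟨x, rfl⟩ := hne
    rw [(placeIdeal_isMaximal x).eq_of_le (ultraMin_isPrime U).ne_top hqU]

theorem placeIdeal_mem_minimalPrimes (hfin : S.Finite)
    (hinf : ∀ w : NumberField.InfinitePlace K, (Sum.inl w : Place K) ∈ S) (x : Place K) :
    placeIdeal x ∈ minimalPrimes (Adeles K) := by
  rw [minimalPrimes_eq_minimals]
  refine ⟨(placeIdeal_isMaximal x).isPrime, fun q hq hqx => ?_⟩
  by_cases hne : ∀ y, q ≠ placeIdeal y
  · obtain ⟨U, hU⟩ := exists_ultraMin_le hq hfin hinf hne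
    exact absurd (hU.trans hqx) (not_ultraMin_le_placeIdeal U x)
  · push Not at hne
    obtain ⟨y, rfl⟩ := hne
    rw [(placeIdeal_isMaximal y).eq_of_le (placeIdeal_isMaximal x).ne_top hqx]

theorem not_placeIdeal_le_ultraMax (U : FreeUltrafilter (PlacesOutside S)) (x : Place K) :
    ¬ placeIdeal x ≤ ultraMax U := by
  intro h
  refine not_ultraMin_le_placeIdeal U x ?_
  rw [(placeIdeal_isMaximal x).eq_of_le (ultraMax_ne_top U) h]
  exact ultraMin_le_ultraMax U

/-! ### Prime ideals between `m_U` and `M_U` -/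

theorem ultraSet_subset {U : FreeUltrafilter (PlacesOutside S)} {p : Ideal (Adeles K)}
    (hp : p.IsPrime) (h : ultraMin U ≤ p) {β : Adeles K} (hβ : β ∈ p) :
    ultraSet U β ⊆ p := by
  rintro α ⟨Y, hY, n, hn⟩
  have hdvd : β ∣ placeIndicator (toPlaces Y) * α ^ n :=
    dvd_placeIndicator_toPlaces_mul hn
  exact hp.mem_of_pow_mem n <| (hp.mem_or_mem (p.mem_of_dvd hdvd hβ)).resolve_left
    ((mem_iff_placeIndicator_notMem hp h Y).1 hY)

/-- The set `p_U^β` contains `α` for `β` the adele `α` cut off to the places outside `S` where it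
is integral. -/
theorem exists_mem_sAdeles_mem_ultraSet (U : FreeUltrafilter (PlacesOutside S))
    {p : Ideal (Adeles K)} {α : Adeles K} (hα : α ∈ p) :
    ∃ β ∈ (p : Set (Adeles K)) ∩ sAdeles S, α ∈ ultraSet U β := by
  refine ⟨placeIndicator (toPlaces {v : PlacesOutside S |
    α.2 v.1 ∈ v.1.adicCompletionIntegers K}) * α, ⟨p.mul_mem_left _ hα, fun v => ?_⟩,
    _, eventually_integral U α, 1, fun v hv => ?_⟩
  · rw [mul_snd_apply, placeIndicator_snd]
    split_ifs with hv
    · rw [one_mul]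
      exact inr_val_mem_toPlaces.1 hv
    · rw [zero_mul]
      exact zero_mem _
  · rw [mul_snd_apply, placeIndicator_snd, if_pos (inr_val_mem_toPlaces.2 hv), one_mul, pow_one]

theorem eq_iUnion_ultraSet {U : FreeUltrafilter (PlacesOutside S)} {p : Ideal (Adeles K)}
    (hp : p.IsPrime) (h : ultraMin U ≤ p) :
    (p : Set (Adeles K)) = ⋃ β ∈ (p : Set (Adeles K)) ∩ sAdeles S, ultraSet U β := by
  refine Set.Subset.antisymm (fun α hα => ?_) (Set.iUnion₂_subset fun β hβ =>
    ultraSet_subset hp h hβ.1)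
  obtain ⟨β, hβ, hαβ⟩ := exists_mem_sAdeles_mem_ultraSet U hα
  exact Set.mem_biUnion hβ hαβ

end

end AdeleSpec


theorem mainTheorem1 (K : Type*) [Field K] [NumberField K]
    (S₀ : Set (AdeleSpec.Place K)) (hfin : S₀.Finite)
    (hinf : ∀ w : NumberField.InfinitePlace K, (Sum.inl w : AdeleSpec.Place K) ∈ S₀) :
    -- the maximal ideals
    (∀ I : Ideal (AdeleSpec.Adeles K), I.IsMaximal ↔
      (∃ v : AdeleSpec.Place K, I = AdeleSpec.placeIdeal v) ∨
      (∃ U : AdeleSpec.FreeUltrafilter (AdeleSpec.PlacesOutside S₀), I = AdeleSpec.ultraMax U)) ∧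
    -- the minimal prime ideals
    (∀ I : Ideal (AdeleSpec.Adeles K), I ∈ minimalPrimes (AdeleSpec.Adeles K) ↔
      (∃ v : AdeleSpec.Place K, I = AdeleSpec.placeIdeal v) ∨
      (∃ U : AdeleSpec.FreeUltrafilter (AdeleSpec.PlacesOutside S₀), I = AdeleSpec.ultraMin U)) ∧
    -- the only minimal prime in `M_U` is `m_U`, the only maximal ideal above `m_U` is `M_U`
    (∀ U : AdeleSpec.FreeUltrafilter (AdeleSpec.PlacesOutside S₀),
      (∀ I ∈ minimalPrimes (AdeleSpec.Adeles K),
        I ≤ AdeleSpec.ultraMax U ↔ I = AdeleSpec.ultraMin U) ∧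
      (∀ I : Ideal (AdeleSpec.Adeles K), I.IsMaximal →
        (AdeleSpec.ultraMin U ≤ I ↔ I = AdeleSpec.ultraMax U))) ∧
    -- the other prime ideals
    (∀ p : Ideal (AdeleSpec.Adeles K), p.IsPrime → ¬ p.IsMaximal →
      p ∉ minimalPrimes (AdeleSpec.Adeles K) →
      (∃! U : AdeleSpec.FreeUltrafilter (AdeleSpec.PlacesOutside S₀),
        AdeleSpec.ultraMin U < p ∧ p < AdeleSpec.ultraMax U) ∧
      (∀ U : AdeleSpec.FreeUltrafilter (AdeleSpec.PlacesOutside S₀),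
        AdeleSpec.ultraMin U < p → p < AdeleSpec.ultraMax U →
        (p : Set (AdeleSpec.Adeles K)) =
          ⋃ β ∈ (p : Set (AdeleSpec.Adeles K)) ∩ AdeleSpec.sAdeles S₀,
            AdeleSpec.ultraSet U β)) := by
  refine ⟨fun I => ⟨fun hI => ?_, ?_⟩, fun I => ⟨fun hI => ?_, ?_⟩,
    fun U => ⟨fun I hI => ⟨fun h => ?_, ?_⟩, fun I hI => ⟨fun h => ?_, ?_⟩⟩,
    fun p hp hmax hmin => ⟨?_, fun U hU _ => AdeleSpec.eq_iUnion_ultraSet hp hU.le⟩⟩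
  · by_cases hne : ∀ x, I ≠ AdeleSpec.placeIdeal x
    · obtain ⟨U, hU⟩ := AdeleSpec.exists_ultraMin_le hI.isPrime hfin hinf hne
      exact Or.inr ⟨U, hI.eq_of_le (AdeleSpec.ultraMax_ne_top U)
        (AdeleSpec.le_ultraMax_of_ultraMin_le hI.isPrime hU)⟩
    · push Not at hne
      exact Or.inl hne
  · rintro (⟨v, rfl⟩ | ⟨U, rfl⟩)
    · exact AdeleSpec.placeIdeal_isMaximal v
    · exact AdeleSpec.ultraMax_isMaximal U
  · by_cases hne : ∀ x, I ≠ AdeleSpec.placeIdeal x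
    · rw [minimalPrimes_eq_minimals] at hI
      obtain ⟨U, hU⟩ := AdeleSpec.exists_ultraMin_le hI.prop hfin hinf hne
      exact Or.inr ⟨U, hI.eq_of_ge (AdeleSpec.ultraMin_isPrime U) hU⟩
    · push Not at hne
      exact Or.inl hne
  · rintro (⟨v, rfl⟩ | ⟨U, rfl⟩)
    · exact AdeleSpec.placeIdeal_mem_minimalPrimes hfin hinf v
    · exact AdeleSpec.ultraMin_mem_minimalPrimes hfin hinf U
  · rw [minimalPrimes_eq_minimals] at hI
    have hne : ∀ x, I ≠ AdeleSpec.placeIdeal x := by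
      rintro x rfl
      exact AdeleSpec.not_placeIdeal_le_ultraMax U x h
    obtain ⟨U', hU'⟩ := AdeleSpec.exists_ultraMin_le hI.prop hfin hinf hne
    obtain rfl := AdeleSpec.eq_of_ultraMin_le (AdeleSpec.ultraMax_isMaximal U).isPrime
      (AdeleSpec.ultraMin_le_ultraMax U) (hU'.trans h)
    exact hI.eq_of_ge (AdeleSpec.ultraMin_isPrime U) hU'
  · rintro rfl
    exact AdeleSpec.ultraMin_le_ultraMax U
  · exact hI.eq_of_le (AdeleSpec.ultraMax_ne_top U)
      (AdeleSpec.le_ultraMax_of_ultraMin_le hI.isPrime h)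
  · rintro rfl
    exact AdeleSpec.ultraMin_le_ultraMax U
  · have hne : ∀ x, p ≠ AdeleSpec.placeIdeal x := by
      rintro x rfl
      exact hmax (AdeleSpec.placeIdeal_isMaximal x)
    obtain ⟨U, hU⟩ := AdeleSpec.exists_ultraMin_le hp hfin hinf hne
    refine ⟨U, ⟨hU.lt_of_ne ?_, (AdeleSpec.le_ultraMax_of_ultraMin_le hp hU).lt_of_ne ?_⟩,
      fun U' hU' => AdeleSpec.eq_of_ultraMin_le hp hU'.1.le hU⟩
    · rintro rfl
      exact hmin (AdeleSpec.ultraMin_mem_minimalPrimes hfin hinf U)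
    · rintro rfl
      exact hmax (AdeleSpec.ultraMax_isMaximal U)
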